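/- Let $U$ be a $(0,1)$-valued random variable whose distribution is absolutely continuous (with respect to Lebesgue measure), let $U_1,U_2,\ldots$ be i.i.d. copies of $U$, and put $\Psi(t)=\mathbb{E}\big((2U-1)\mathbf{1}\{U\ge t\}\big)$ for $t\in(0,1)$. Let $\mathbb{H}=L^2((0,1),\mathcal{B},\mathrm{d}t)$ be the real Hilbert space of (classes of) square-integrable Borel functions on $(0,1)$, with inner product $\langle f,g\rangle=\int_0^1 f(t)g(t)\,\mathrm{d}t$, and for $n\ge 1$ let $W_n$ be the random element of $\mathbb{H}$ given by $$W_n(t)=\sqrt{n}\Big(\frac1n\sum_{j=1}^n(2U_j-1)\mathbf{1}\{U_j\ge t\}-\Psi(t)\Big),\qquad t\in(0,1).$$ Then there exists a centred Gaussian random element $W$ of $\mathbb{H}$ with covariance kernel $$K_W(s,t)=\mathbb{E}\big((2U-1)^2\mathbf{1}\{U\ge\max(s,t)\}\big)-\Psi(s)\Psi(t),\qquad s,t\in(0,1),$$ that is, $\operatorname{Cov}(\langle f,W\rangle,\langle g,W\rangle)=\int_0^1\int_0^1K_W(s,t)f(s)g(t)\,\mathrm{d}t\,\mathrm{d}s$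 for all $f,g\in\mathbb{H}$, such that $W_n$ converges in distribution (weakly) to $W$ in $\mathbb{H}$ as $n\to\infty$. -/

import Mathlib

open MeasureTheory ProbabilityTheory Filter Topology
open scoped RealInnerProductSpace

noncomputable section

namespace UniformityTest

/-- Lebesgue measure on the open unit interval `(0,1)`. -/
abbrev vol01 : Measure ℝ := volume.restrict (Set.Ioo (0 : ℝ) 1)

/-- The separable Hilbert space `L²((0,1), ℬ, dt)`. -/
abbrev H : Type := Lp ℝ 2 vol01

/-- `H` carries its Borel sigma-field. -/
instance instMeasurableSpaceH : MeasurableSpace H := borel H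

instance instBorelSpaceH : BorelSpace H := ⟨rfl⟩

/-- The summand `(2u - 1) 1{u ≥ t}`. -/
def summand (u t : ℝ) : ℝ := (2 * u - 1) * (Set.Ici t).indicator (fun _ => (1 : ℝ)) u

/-- `Ψ(t) = E((2U - 1) 1{U ≥ t})`. -/
def Psi {Ω : Type*} [MeasurableSpace Ω] (P : Measure Ω) (U : Ω → ℝ) (t : ℝ) : ℝ :=
  ∫ ω, summand (U ω) t ∂P

/-- `K_W(s,t) = E((2U - 1)² 1{U ≥ max(s,t)}) - Ψ(s) Ψ(t)`. -/
def covKernel {Ω : Type*} [MeasurableSpace Ω] (P : Measure Ω) (U : Ω → ℝ) (s t : ℝ) : ℝ :=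
  (∫ ω, (2 * U ω - 1) ^ 2 * (Set.Ici (max s t)).indicator (fun _ => (1 : ℝ)) (U ω) ∂P)
    - Psi P U s * Psi P U t

/-- The function `t ↦ √n (n⁻¹ ∑_{j=1}^n (2u_j - 1) 1{u_j ≥ t} - Ψ(t))` for a realisation
`u_1, …, u_n` of the sample, indexed here by `j = 0, …, n - 1`. -/
def processFun {Ω : Type*} [MeasurableSpace Ω] (P : Measure Ω) (U : Ω → ℝ)
    (u : ℕ → ℝ) (n : ℕ) (t : ℝ) : ℝ :=
  √(n : ℝ) * ((n : ℝ)⁻¹ * ∑ j ∈ Finset.range n, summand (u j) t - Psi P U t)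

theorem measurable_summand : Measurable (fun p : ℝ × ℝ => summand p.1 p.2) := by
  have h : (fun p : ℝ × ℝ => summand p.1 p.2) =
      fun p => (2 * p.1 - 1) * ({q : ℝ × ℝ | q.2 ≤ q.1}.indicator (fun _ => (1 : ℝ)) p) := by
    funext p
    simp [summand, Set.indicator_apply]
  rw [h]
  exact ((measurable_fst.const_mul 2).sub_const 1).mul
    (measurable_const.indicator (measurableSet_le measurable_snd measurable_fst))

theorem abs_summand_le (u t : ℝ) : |summand u t| ≤ |2 * u - 1| := by
  unfold summand
  by_cases h : u ∈ Set.Ici t <;> simp [h]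

theorem memLp_summand (u : ℝ) : MemLp (summand u) 2 vol01 :=
  MemLp.of_bound (measurable_summand.comp measurable_prodMk_left).aestronglyMeasurable
    |2 * u - 1| (Eventually.of_forall fun t => abs_summand_le u t)

theorem memLp_Psi {Ω : Type*} [MeasurableSpace Ω] (P : Measure Ω) [IsProbabilityMeasure P]
    {U : Ω → ℝ} (hU : AEMeasurable U P) (hU01 : ∀ᵐ ω ∂P, U ω ∈ Set.Ioo (0 : ℝ) 1) :
    MemLp (Psi P U) 2 vol01 := by
  have : IsProbabilityMeasure (P.map U) := Measure.isProbabilityMeasure_map hU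
  have hPsi : Psi P U = fun t => ∫ u, summand u t ∂(P.map U) := by
    funext t
    exact (integral_map hU
      (measurable_summand.comp measurable_prodMk_right).aestronglyMeasurable).symm
  have hm : StronglyMeasurable (Psi P U) := by
    rw [hPsi]
    exact (measurable_summand.comp measurable_swap).stronglyMeasurable.integral_prod_right'
  refine MemLp.of_bound hm.aestronglyMeasurable 1 (Eventually.of_forall fun t => ?_)
  have h := norm_integral_le_of_norm_le_const (μ := P) (f := fun ω => summand (U ω) t) (C := 1)
    (by
      filter_upwards [hU01] with ω hω
      refine (abs_summand_le _ _).trans (abs_le.2 ⟨?_, ?_⟩) <;> linarith [hω.1, hω.2])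
  simpa [Psi] using h

theorem memLp_processFun {Ω : Type*} [MeasurableSpace Ω] (P : Measure Ω) [IsProbabilityMeasure P]
    {U : Ω → ℝ} (hU : AEMeasurable U P) (hU01 : ∀ᵐ ω ∂P, U ω ∈ Set.Ioo (0 : ℝ) 1)
    (u : ℕ → ℝ) (n : ℕ) : MemLp (processFun P U u n) 2 vol01 :=
  (((memLp_finsetSum (Finset.range n) fun j _ => memLp_summand (u j)).const_mul
    (n : ℝ)⁻¹).sub (memLp_Psi P hU hU01)).const_mul √(n : ℝ)

/-- The random element `W_n` of `H`: the class of `processFun` at the sample `U_1(ω), …, U_n(ω)`. -/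
def Wn {Ω Ω' : Type*} [MeasurableSpace Ω] (P : Measure Ω) [IsProbabilityMeasure P]
    {U : Ω → ℝ} (hU : AEMeasurable U P) (hU01 : ∀ᵐ ω ∂P, U ω ∈ Set.Ioo (0 : ℝ) 1)
    (X : ℕ → Ω' → ℝ) (n : ℕ) (ω : Ω') : H :=
  (memLp_processFun P hU hU01 (fun j => X j ω) n).toLp (processFun P U (fun j => X j ω) n)

/-- `W` is a centred Gaussian element of `H` with covariance kernel `K`: its covariance form is
`Cov(⟨f, W⟩, ⟨g, W⟩) = ∫₀¹ ∫₀¹ K(s,t) f(s) g(t) dt ds`, i.e. its covariance operator is the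
integral operator with kernel `K`. -/
structure IsCentredGaussianWithKernel {Ω : Type*} [MeasurableSpace Ω] (Q : Measure Ω)
    (W : Ω → H) (K : ℝ → ℝ → ℝ) : Prop where
  measurable : Measurable W
  gaussian : IsGaussian (Q.map W)
  centred : ∀ f : H, ∫ ω, ⟪f, W ω⟫ ∂Q = 0
  covariance : ∀ f g : H, cov[fun ω => ⟪f, W ω⟫, fun ω => ⟪g, W ω⟫; Q] =
    ∫ s in Set.Ioo (0 : ℝ) 1, ∫ t in Set.Ioo (0 : ℝ) 1, K s t * f s * g t

end UniformityTest

end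

/-!
The theorem is an instance of the central limit theorem in a separable Hilbert space. With
`G u ∈ H` the class of `t ↦ (2u - 1) 1{u ≥ t}`, the random element `W_n` is the normalised sum
`n^{-1/2} ∑ (G(U_j) - Ψ)` of i.i.d. bounded centred random elements of `H`.

For i.i.d. centred square-integrable `X_j` in a separable Hilbert space `E`, with normalised sums
`S_n`, two facts give the limit theorem.

* Tightness (`isTightMeasureSet_map_normalizedSum`). Orthogonality of independent centred variables
  gives `𝔼‖T S_n‖² ≤ 𝔼‖T X_0‖²` for every bounded operator `T`, uniformly in `n`. Taking
  `T = 1 - P_k`, with `P_k` the projections onto an increasing sequence of finite-dimensional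
  subspaces with dense union, the right-hand side tends to `0` by dominated convergence, so the
  `S_n` are uniformly close to finite-dimensional sets with high probability.
* Convergence of characteristic functions (`tendsto_charFun_map_normalizedSum`), which is the
  one-dimensional central limit theorem applied to `⟪t, S_n⟫`.

By Prokhorov's theorem the laws of `S_n` have a cluster point. Its characteristic function is the
pointwise limit `exp (-C t t / 2)`, where `C` is the covariance of `X_0`, so it is a centred
Gaussian measure with covariance `C`. In particular the Gaussian limit needs no separate construction.
Characteristic functions separate points, hence by tightness the whole sequence converges to it
(`exists_isGaussian_tendsto_map_normalizedSum`).

It remains to identify the covariance of `⟪f, G(U)⟫` and `⟪g, G(U)⟫` with the integral against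
`covKernel`, which is Fubini's theorem (`covariance_inner_summandLp`).
-/

namespace HilbertCLT

/-! ### Tightness in Hilbert spaces -/

open scoped ENNReal NNReal

variable {E : Type*} [NormedAddCommGroup E] [InnerProductSpace ℝ E]

/-- The points of a ball within distance `r k → 0` of each finite-dimensional subspace `V k` form a
compact set: it is closed, and totally bounded because balls of `V k` are. -/
theorem isCompact_setOf_norm_sub_starProjection_le [CompleteSpace E]
    (V : ℕ → Submodule ℝ E) [∀ k, FiniteDimensional ℝ (V k)] (R : ℝ) {r : ℕ → ℝ}
    (hr : Tendsto r atTop (𝓝 0)) :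
    IsCompact {x : E | ‖x‖ ≤ R ∧ ∀ k, ‖x - (V k).starProjection x‖ ≤ r k} := by
  refine TotallyBounded.isCompact_of_isClosed ?_ ?_
  · rw [Metric.totallyBounded_iff]
    intro ε hε
    obtain ⟨k, hk⟩ := (hr.eventually_lt_const (half_pos hε)).exists
    have hcomp : IsCompact ((fun v : V k => (v : E)) '' Metric.closedBall 0 R) :=
      (isCompact_closedBall (0 : V k) R).image continuous_subtype_val
    obtain ⟨t, ht, hcov⟩ := Metric.totallyBounded_iff.1 hcomp.totallyBounded _ (half_pos hε)
    refine ⟨t, ht, fun x hx => ?_⟩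
    have hPx : (V k).starProjection x ∈ (fun v : V k => (v : E)) '' Metric.closedBall 0 R := by
      refine ⟨⟨(V k).starProjection x, Submodule.starProjection_apply_mem _ x⟩, ?_, rfl⟩
      simpa using ((V k).norm_starProjection_apply_le x).trans hx.1
    obtain ⟨y, hy, hxy⟩ := Set.mem_iUnion₂.1 (hcov hPx)
    refine Set.mem_iUnion₂.2 ⟨y, hy, ?_⟩
    rw [Metric.mem_ball] at hxy ⊢
    calc dist x y ≤ dist x ((V k).starProjection x) + dist ((V k).starProjection x) y :=
          dist_triangle _ _ _
      _ < ε / 2 + ε / 2 := by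
          refine add_lt_add ?_ hxy
          rw [dist_eq_norm]
          exact (hx.2 k).trans_lt hk
      _ = ε := add_halves ε
  · have heq : {x : E | ‖x‖ ≤ R ∧ ∀ k, ‖x - (V k).starProjection x‖ ≤ r k} =
        {x | ‖x‖ ≤ R} ∩ ⋂ k, {x | ‖x - (V k).starProjection x‖ ≤ r k} := by
      ext
      simp
    rw [heq]
    exact (isClosed_le continuous_norm continuous_const).inter
      (isClosed_iInter fun k => isClosed_le (by fun_prop) continuous_const)

/-- A set of measures with bounded second moments is tight if the second moments of the distance to
the finite-dimensional subspaces `V k` tend to `0` uniformly over the set. -/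
theorem isTightMeasureSet_of_lintegral_sub_starProjection_le [CompleteSpace E]
    [MeasurableSpace E] [BorelSpace E] [SecondCountableTopology E]
    {S : Set (Measure E)} (V : ℕ → Submodule ℝ E)
    [∀ k, FiniteDimensional ℝ (V k)] {C : ℝ≥0∞} (hC : C ≠ ∞)
    (hbdd : ∀ μ ∈ S, ∫⁻ x, ‖x‖ₑ ^ 2 ∂μ ≤ C) {a : ℕ → ℝ≥0∞} (ha : Tendsto a atTop (𝓝 0))
    (hproj : ∀ k, ∀ μ ∈ S, ∫⁻ x, ‖x - (V k).starProjection x‖ₑ ^ 2 ∂μ ≤ a k) :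
    IsTightMeasureSet S := by
  rw [isTightMeasureSet_iff_exists_isCompact_measure_compl_le]
  intro ε hε
  -- Chebyshev's inequality for `f`.
  have markov (μ : Measure E) (f : E → E) (hf : Measurable f) (r : ℝ) (hr : 0 < r) :
      μ {x | r < ‖f x‖} ≤ (∫⁻ x, ‖f x‖ₑ ^ 2 ∂μ) / ENNReal.ofReal r ^ 2 := by
    refine le_trans (measure_mono fun x hx => ?_)
      (meas_ge_le_lintegral_div (by fun_prop) (by simp [hr]) (by simp))
    simp only [Set.mem_ofPred_eq] at hx ⊢
    gcongr
    rw [← ofReal_norm]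
    exact ENNReal.ofReal_le_ofReal hx.le
  have hε2 : ε / 2 ≠ 0 := (ENNReal.half_pos hε.ne').ne'
  -- Half of the allowed mass `ε` is spent on the norm bound `R`, and `δ k` on the `k`-th distance.
  obtain ⟨δ, hδ, hδsum⟩ := ENNReal.exists_pos_sum_of_countable hε2 ℕ
  have hR : ∃ R : ℝ, 0 < R ∧ C / ENNReal.ofReal R ^ 2 ≤ ε / 2 := by
    have : Tendsto (fun R : ℝ => C / ENNReal.ofReal R ^ 2) atTop (𝓝 0) := by
      have h := ENNReal.Tendsto.const_div (a := C)
        (((ENNReal.continuous_pow 2).tendsto ∞).comp ENNReal.tendsto_ofReal_atTop) (Or.inr hC)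
      simpa using h
    obtain ⟨R, h1, h2⟩ := ((eventually_gt_atTop 0).and
      (this.eventually_le_const (pos_iff_ne_zero.2 hε2))).exists
    exact ⟨R, h1, h2⟩
  obtain ⟨R, hR0, hR⟩ := hR
  set r : ℕ → ℝ := fun k => 1 / ((k : ℝ) + 1) with hr_def
  have hr0 k : 0 < r k := by positivity
  have hN : ∀ k, ∃ N, a N / ENNReal.ofReal (r k) ^ 2 ≤ δ k := by
    intro k
    have : Tendsto (fun N => a N / ENNReal.ofReal (r k) ^ 2) atTop (𝓝 0) := by
      have h := ENNReal.Tendsto.div_const (b := ENNReal.ofReal (r k) ^ 2) ha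
        (Or.inr (by simp [hr0 k]))
      simpa using h
    exact (this.eventually_le_const (by exact_mod_cast hδ k)).exists
  choose N hN using hN
  refine ⟨_, isCompact_setOf_norm_sub_starProjection_le (fun k => V (N k)) R
    (r := r) tendsto_one_div_add_atTop_nhds_zero_nat, fun μ hμ => ?_⟩
  have hsub : {x : E | ‖x‖ ≤ R ∧ ∀ k, ‖x - (V (N k)).starProjection x‖ ≤ r k}ᶜ ⊆
      {x | R < ‖x‖} ∪ ⋃ k, {x | r k < ‖x - (V (N k)).starProjection x‖} := by
    intro x hx
    simp only [Set.mem_compl_iff, Set.mem_ofPred_eq, not_and_or, not_forall, not_le] at hx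
    simpa using hx
  calc μ _ ≤ μ {x | R < ‖x‖} + ∑' k, μ {x | r k < ‖x - (V (N k)).starProjection x‖} :=
        (measure_mono hsub).trans ((measure_union_le _ _).trans
          (add_le_add le_rfl (measure_iUnion_le _)))
    _ ≤ ε / 2 + ∑' k, (δ k : ℝ≥0∞) := by
        refine add_le_add ?_ (ENNReal.tsum_le_tsum fun k => ?_)
        · exact (markov μ (fun x => x) measurable_id R hR0).trans
            ((ENNReal.div_le_div_right (hbdd μ hμ) _).trans hR)
        · exact (markov μ _ (by fun_prop) (r k) (hr0 k)).trans
            ((ENNReal.div_le_div_right (hproj _ μ hμ) _).trans (hN k))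
    _ ≤ ε / 2 + ε / 2 := by gcongr
    _ = ε := ENNReal.add_halves ε

theorem exists_monotone_finiteDimensional_dense [SecondCountableTopology E] :
    ∃ V : ℕ → Submodule ℝ E, (∀ k, FiniteDimensional ℝ (V k)) ∧ Monotone V ∧
      ⊤ ≤ (⨆ k, V k).topologicalClosure := by
  refine ⟨fun k => Submodule.span ℝ (TopologicalSpace.denseSeq E '' Set.Iio k), fun k => ?_,
    fun i j hij => Submodule.span_mono (Set.image_mono (Set.Iio_subset_Iio hij)), fun x _ => ?_⟩
  · exact FiniteDimensional.span_of_finite ℝ ((Set.finite_Iio k).image _)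
  · have hx : x ∈ closure (Set.range (TopologicalSpace.denseSeq E)) :=
      TopologicalSpace.denseRange_denseSeq E x
    refine closure_mono ?_ hx
    rintro _ ⟨k, rfl⟩
    exact Submodule.mem_iSup_of_mem (k + 1)
      (Submodule.subset_span ⟨k, Set.mem_Iio.2 (Nat.lt_succ_self k), rfl⟩)

/-! ### The central limit theorem in a separable Hilbert space -/

variable [CompleteSpace E] [MeasurableSpace E] [BorelSpace E] [SecondCountableTopology E]
  {Ω : Type*} [MeasurableSpace Ω] {P : Measure Ω} [IsProbabilityMeasure P]
  {X : ℕ → Ω → E}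

omit [SecondCountableTopology E] in
theorem integral_norm_sum_sq (hindep : iIndepFun X P)
    (hident : ∀ j, IdentDistrib (X j) (X 0) P P) (hX : MemLp (X 0) 2 P) (h0 : P[X 0] = 0)
    (n : ℕ) : ∫ ω, ‖∑ j ∈ Finset.range n, X j ω‖ ^ 2 ∂P = n * ∫ ω, ‖X 0 ω‖ ^ 2 ∂P := by
  have hL2 j : MemLp (X j) 2 P := (hident j).memLp_iff.2 hX
  have hint j : Integrable (X j) P := (hL2 j).integrable one_le_two
  have hmean j : P[X j] = 0 := (hident j).integral_eq.trans h0
  have hinner i j : Integrable (fun ω => ⟪X i ω, X j ω⟫) P :=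
    (L2.integrable_inner (𝕜 := ℝ) (hL2 i).toLp (hL2 j).toLp).congr (by
      filter_upwards [(hL2 i).coeFn_toLp, (hL2 j).coeFn_toLp] with ω h1 h2
      rw [h1, h2])
  have horth i j (hij : i ≠ j) : ∫ ω, ⟪X i ω, X j ω⟫ ∂P = 0 := by
    have h := (hindep.indepFun hij).integral_bilin (hint i) (hint j) (innerSL ℝ)
    rw [hmean i, map_zero] at h
    exact h
  have hdiag i : ∫ ω, ⟪X i ω, X i ω⟫ ∂P = ∫ ω, ‖X 0 ω‖ ^ 2 ∂P := by
    simp_rw [real_inner_self_eq_norm_sq]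
    exact ((hident i).comp (u := fun x : E => ‖x‖ ^ 2) (by fun_prop)).integral_eq
  simp_rw [← real_inner_self_eq_norm_sq, sum_inner, inner_sum]
  rw [integral_finsetSum _ fun i _ => integrable_finsetSum _ fun j _ => hinner i j]
  simp_rw [integral_finsetSum _ fun j _ => hinner _ j]
  rw [Finset.sum_congr rfl (g := fun _ => ∫ ω, ‖X 0 ω‖ ^ 2 ∂P)]
  · simp
  · intro i hi
    rw [Finset.sum_eq_single i (fun j _ hji => horth i j hji.symm) (fun h => absurd hi h), hdiag]

/-- The normalised sum `n^{-1/2} ∑_{j < n} X_j`, which is `0` for `n = 0`. -/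
noncomputable def normalizedSum (X : ℕ → Ω → E) (n : ℕ) (ω : Ω) : E :=
  (√(n : ℝ))⁻¹ • ∑ j ∈ Finset.range n, X j ω

omit [SecondCountableTopology E] in
/-- Equality holds except for `n = 0`, where the left-hand side vanishes. -/
theorem lintegral_enorm_clm_normalizedSum_sq_le (hindep : iIndepFun X P)
    (hident : ∀ j, IdentDistrib (X j) (X 0) P P) (hX : MemLp (X 0) 2 P) (h0 : P[X 0] = 0)
    (T : E →L[ℝ] E) (n : ℕ) :
    ∫⁻ ω, ‖T (normalizedSum X n ω)‖ₑ ^ 2 ∂P ≤ ∫⁻ ω, ‖T (X 0 ω)‖ₑ ^ 2 ∂P := by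
  have hL2 j : MemLp (X j) 2 P := (hident j).memLp_iff.2 hX
  have hTL2 j : MemLp (fun ω => T (X j ω)) 2 P := T.comp_memLp' (hL2 j)
  have key := integral_norm_sum_sq (X := fun j ω => T (X j ω))
    (hindep.comp (fun _ x => T x) fun _ => by fun_prop)
    (fun j => (hident j).comp (u := fun x => T x) (by fun_prop)) (hTL2 0)
    (by rw [T.integral_comp_comm (hX.integrable one_le_two), h0, map_zero]) n
  have conv (Y : Ω → E) (hY : MemLp Y 2 P) :
      ∫⁻ ω, ‖Y ω‖ₑ ^ 2 ∂P = ENNReal.ofReal (∫ ω, ‖Y ω‖ ^ 2 ∂P) := by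
    rw [ofReal_integral_eq_lintegral_ofReal (hY.integrable_norm_pow (by norm_num))
      (Eventually.of_forall fun _ => by positivity)]
    refine lintegral_congr fun ω => ?_
    rw [ENNReal.ofReal_pow (norm_nonneg _), ofReal_norm]
  have hsum : MemLp (fun ω => T (normalizedSum X n ω)) 2 P :=
    T.comp_memLp' ((memLp_finsetSum (Finset.range n) fun j _ => hL2 j).const_smul _)
  rw [conv _ hsum, conv _ (hTL2 0)]
  refine ENNReal.ofReal_le_ofReal ?_
  have : ∀ ω, ‖T (normalizedSum X n ω)‖ ^ 2 =
      (n : ℝ)⁻¹ * ‖∑ j ∈ Finset.range n, T (X j ω)‖ ^ 2 := by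
    intro ω
    rw [normalizedSum, map_smul, map_sum, norm_smul, mul_pow, norm_inv, Real.norm_eq_abs,
      inv_pow, sq_abs, Real.sq_sqrt (Nat.cast_nonneg n)]
  simp_rw [this]
  rw [integral_const_mul, key, ← mul_assoc]
  refine mul_le_of_le_one_left (by positivity) ?_
  exact inv_mul_le_one

omit [CompleteSpace E] [IsProbabilityMeasure P] in
theorem aemeasurable_normalizedSum (hX : ∀ j, AEMeasurable (X j) P) (n : ℕ) :
    AEMeasurable (normalizedSum X n) P :=
  (Finset.aemeasurable_fun_sum _ fun j _ => hX j).const_smul _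

theorem isTightMeasureSet_map_normalizedSum (hindep : iIndepFun X P)
    (hident : ∀ j, IdentDistrib (X j) (X 0) P P) (hX : MemLp (X 0) 2 P) (h0 : P[X 0] = 0) :
    IsTightMeasureSet (Set.range fun n => P.map (normalizedSum X n)) := by
  obtain ⟨V, hfin, hmono, hdense⟩ := exists_monotone_finiteDimensional_dense (E := E)
  have hmeas n : AEMeasurable (normalizedSum X n) P :=
    aemeasurable_normalizedSum (fun j => (hident j).aemeasurable_fst) n
  have hfinite : ∫⁻ ω, ‖X 0 ω‖ₑ ^ 2 ∂P ≠ ∞ := by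
    have h := (lintegral_rpow_enorm_lt_top_of_eLpNorm_lt_top (by norm_num) (by norm_num) hX.2).ne
    simpa using h
  have hbound (T : E →L[ℝ] E) (n : ℕ) : ∫⁻ x, ‖T x‖ₑ ^ 2 ∂(P.map (normalizedSum X n)) ≤
      ∫⁻ ω, ‖T (X 0 ω)‖ₑ ^ 2 ∂P := by
    rw [lintegral_map' (by fun_prop) (hmeas n)]
    exact lintegral_enorm_clm_normalizedSum_sq_le hindep hident hX h0 T n
  refine isTightMeasureSet_of_lintegral_sub_starProjection_le V hfinite ?_
    (a := fun k => ∫⁻ ω, ‖X 0 ω - (V k).starProjection (X 0 ω)‖ₑ ^ 2 ∂P) ?_ ?_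
  · rintro _ ⟨n, rfl⟩
    exact hbound (ContinuousLinearMap.id ℝ E) n
  · have hmX := (hident 0).aemeasurable_fst
    have := tendsto_lintegral_of_dominated_convergence' (μ := P)
      (F := fun k ω => ‖X 0 ω - (V k).starProjection (X 0 ω)‖ₑ ^ 2) (f := fun _ => 0)
      (fun ω => ‖X 0 ω‖ₑ ^ 2) (fun k => by fun_prop) (fun k => ?_) hfinite ?_
    · simpa using this
    · refine Eventually.of_forall fun ω => ?_
      refine pow_le_pow_left' ?_ 2
      rw [enorm_le_iff_norm_le, ← Submodule.starProjection_orthogonal_val]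
      exact Submodule.norm_starProjection_apply_le _ _
    · refine Eventually.of_forall fun ω => ?_
      have h1 := (Submodule.starProjection_tendsto_self V hmono (X 0 ω) hdense).const_sub (X 0 ω)
      have h2 := ((ENNReal.continuous_pow 2).tendsto _).comp h1.enorm
      simpa [Function.comp_def] using h2
  · rintro k _ ⟨n, rfl⟩
    exact hbound (ContinuousLinearMap.id ℝ E - (V k).starProjection) n

/-- The characteristic function of `S_n` at `t` is that of `⟪t, S_n⟫` at `1`, so that the
one-dimensional central limit theorem applies. It covers the degenerate case of zero variance. -/
theorem tendsto_charFun_map_normalizedSum (hindep : iIndepFun X P)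
    (hident : ∀ j, IdentDistrib (X j) (X 0) P P) (hX : MemLp (X 0) 2 P) (h0 : P[X 0] = 0)
    (t : E) :
    Tendsto (fun n => charFun (P.map (normalizedSum X n)) t) atTop
      (𝓝 (Complex.exp (-(covarianceBilin (P.map (X 0)) t t / 2 : ℝ)))) := by
  have hmX := (hident 0).aemeasurable_fst
  have hmeas n : AEMeasurable (normalizedSum X n) P :=
    aemeasurable_normalizedSum (fun j => (hident j).aemeasurable_fst) n
  set Y : ℕ → Ω → ℝ := fun j ω => ⟪t, X j ω⟫ with hY
  have hY0 : P[Y 0] = 0 := by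
    simp only [hY]
    rw [integral_inner (hX.integrable one_le_two), h0, inner_zero_right]
  have hclt := tendstoInDistribution_inv_sqrt_mul_sum_sub (X := Y) (P := P) (Y := id)
    (P' := gaussianReal 0 Var[Y 0; P].toNNReal) ⟨aemeasurable_id, Measure.map_id⟩
    (hX.const_inner t) (hindep.comp (fun _ x => ⟪t, x⟫) fun _ => by fun_prop)
    (fun j => (hident j).comp (u := fun x => ⟪t, x⟫) (by fun_prop))
  have h := ProbabilityMeasure.tendsto_iff_tendsto_charFun.1 hclt.tendsto 1
  have hvar : Var[Y 0; P] = covarianceBilin (P.map (X 0)) t t := by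
    rw [covarianceBilin_self ((memLp_map_measure_iff aestronglyMeasurable_id hmX).2 hX),
      variance_map (by fun_prop) hmX]
    rfl
  have hlim : charFun (Measure.map id (gaussianReal 0 Var[Y 0; P].toNNReal)) 1 =
      Complex.exp (-(covarianceBilin (P.map (X 0)) t t / 2 : ℝ)) := by
    rw [Measure.map_id, charFun_gaussianReal, ← hvar,
      Real.coe_toNNReal _ (variance_nonneg _ _)]
    push_cast
    ring_nf
  simp only [ProbabilityMeasure.coe_mk] at h
  rw [hlim] at h
  refine h.congr fun n => ?_
  have hfun : (fun ω => (√(n : ℝ))⁻¹ * (∑ k ∈ Finset.range n, Y k ω - n * ∫ ω, Y 0 ω ∂P)) =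
      fun ω => ⟪t, normalizedSum X n ω⟫ := by
    funext ω
    rw [hY0, mul_zero, sub_zero, normalizedSum, inner_smul_right, inner_sum]
  have hmeas' : AEMeasurable (fun ω => ⟪t, normalizedSum X n ω⟫) P :=
    (by fun_prop : Measurable fun x : E => ⟪t, x⟫).comp_aemeasurable (hmeas n)
  rw [charFun_apply, charFun_apply, integral_map (hmeas n) (by fun_prop), hfun,
    integral_map hmeas' (by fun_prop)]
  refine integral_congr_ae (Eventually.of_forall fun ω => ?_)
  simp [real_inner_comm]

/-- **Central limit theorem** in a separable Hilbert space, including the existence of a centred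
Gaussian measure with the covariance of `X 0`. -/
theorem exists_isGaussian_tendsto_map_normalizedSum (hindep : iIndepFun X P)
    (hident : ∀ j, IdentDistrib (X j) (X 0) P P) (hX : MemLp (X 0) 2 P) (h0 : P[X 0] = 0) :
    ∃ μ : ProbabilityMeasure E, IsGaussian (μ : Measure E) ∧ ∫ x, x ∂(μ : Measure E) = 0 ∧
      covarianceBilin (μ : Measure E) = covarianceBilin (P.map (X 0)) ∧
      TendstoInDistribution (normalizedSum X) atTop id (fun _ => P) (μ : Measure E) := by
  have hmeas n : AEMeasurable (normalizedSum X n) P :=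
    aemeasurable_normalizedSum (fun j => (hident j).aemeasurable_fst) n
  let ν : ℕ → ProbabilityMeasure E := fun n =>
    ⟨P.map (normalizedSum X n), Measure.isProbabilityMeasure_map (hmeas n)⟩
  have htight : IsTightMeasureSet {((ν n : ProbabilityMeasure E) : Measure E) | n} :=
    isTightMeasureSet_map_normalizedSum hindep hident hX h0
  have hcomp : IsCompact (closure (Set.range ν)) :=
    isCompact_closure_of_isTightMeasureSet (by simpa using htight)
  have hchar := tendsto_charFun_map_normalizedSum hindep hident hX h0
  -- An ultrafilter finer than `atTop` picks a cluster point `μ` of the sequence of laws.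
  let U : Ultrafilter ℕ := Ultrafilter.of atTop
  have hU : (U : Filter ℕ) ≤ atTop := Ultrafilter.of_le atTop
  obtain ⟨μ, -, hμ⟩ := hcomp.ultrafilter_le_nhds (U.map ν)
    (le_principal_iff.2 (Filter.mem_map.2 (Filter.univ_mem' fun n =>
      subset_closure (Set.mem_range_self n))))
  have hμ' : Tendsto ν U (𝓝 μ) := hμ
  have hμchar t : charFun (μ : Measure E) t =
      Complex.exp (-(covarianceBilin (P.map (X 0)) t t / 2 : ℝ)) := by
    refine tendsto_nhds_unique ?_ ((hchar t).mono_left hU)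
    have h := (ProbabilityMeasure.tendsto_iff_forall_integral_rclike_tendsto ℂ).1 hμ'
      (BoundedContinuousFunction.innerProbChar t)
    change Tendsto (fun n => charFun (ν n : Measure E) t) _ _
    simpa only [← charFun_eq_integral_innerProbChar] using h
  have hμchar' t : charFun (μ : Measure E) t =
      Complex.exp (⟪t, (0 : E)⟫ * Complex.I - covarianceBilin (P.map (X 0)) t t / 2) := by
    rw [hμchar, inner_zero_right]
    push_cast
    ring_nf
  have hpos := isPosSemidef_covarianceBilin (μ := P.map (X 0))
  obtain ⟨hm, hc⟩ := gaussian_charFun_congr 0 _ hpos hμchar'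
  refine ⟨μ, isGaussian_iff_gaussian_charFun.2 ⟨0, _, hpos, hμchar'⟩, hm.symm, hc.symm,
    hmeas, aemeasurable_id, ?_⟩
  have hconv : Tendsto ν atTop (𝓝 μ) := by
    refine ProbabilityMeasure.tendsto_of_tight_of_separatesPoints htight (𝕜 := ℂ)
      (A := BoundedContinuousFunction.charPoly Real.continuous_probChar (L := innerₗ E)
        continuous_inner) ?_ fun g hg => ?_
    · refine BoundedContinuousFunction.separatesPoints_charPoly Real.continuous_probChar
        Real.probChar_ne_one _ ?_
      exact fun v hv => DFunLike.ne_iff.mpr ⟨v, inner_self_ne_zero.mpr hv⟩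
    · refine ProbabilityMeasure.tendsto_charPoly_of_tendsto_charFun (fun t => ?_) hg
      rw [hμchar]
      exact hchar t
  convert hconv using 2
  exact congrArg 𝓝 (Subtype.ext Measure.map_id)

end HilbertCLT

namespace UniformityTest

open scoped ENNReal

/-! ### The summand as an element of the Hilbert space -/

/-- Mathlib derives the separability of `L^p` from this fact. -/
instance fact_two_ne_top : Fact ((2 : ℝ≥0∞) ≠ ∞) := ⟨by simp⟩

/-- The class in `H` of the function `t ↦ (2u - 1) 1{u ≥ t}`. -/
noncomputable def summandLp (u : ℝ) : H := (memLp_summand u).toLp (summand u)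

/-- The classes of `1{t ≤ u}` and `1{t ≤ v}` are at distance at most `√|u - v|`. The continuity of
`summandLp` makes `summandLp (U ω)` a random element of `H`. -/
theorem continuous_summandLp : Continuous summandLp := by
  have hfin (u : ℝ) : vol01 (Set.Iic u) ≠ ∞ := measure_ne_top _ _
  have hcont : Continuous fun u : ℝ =>
      indicatorConstLp 2 (measurableSet_Iic (a := u)) (hfin u) (1 : ℝ) := by
    refine continuous_indicatorConstLp_set (by simp) fun u => ?_
    have hlim : Tendsto (fun v : ℝ => ENNReal.ofReal (|v - u|)) (𝓝 u) (𝓝 0) := by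
      have h : Tendsto (fun v : ℝ => |v - u|) (𝓝 u) (𝓝 |u - u|) := by
        exact ((continuous_id.sub continuous_const).abs).tendsto u
      simpa using ENNReal.tendsto_ofReal h
    refine tendsto_of_tendsto_of_tendsto_of_le_of_le tendsto_const_nhds hlim
      (fun _ => zero_le) fun v => ?_
    calc vol01 (symmDiff (Set.Iic v) (Set.Iic u)) ≤ volume (Set.uIoc u v) := by
          refine (Measure.restrict_apply_le _ _).trans (measure_mono fun x hx => ?_)
          rw [Set.mem_uIoc]
          simp only [Set.mem_symmDiff, Set.mem_Iic, not_le] at hx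
          tauto
      _ = ENNReal.ofReal |v - u| := by rw [Real.volume_uIoc]
  have heq : summandLp = fun u : ℝ =>
      (2 * u - 1) • indicatorConstLp 2 (measurableSet_Iic (a := u)) (hfin u) (1 : ℝ) := by
    funext u
    refine Lp.ext ?_
    filter_upwards [(memLp_summand u).coeFn_toLp, Lp.coeFn_smul (2 * u - 1)
      (indicatorConstLp 2 (measurableSet_Iic (a := u)) (hfin u) (1 : ℝ)),
      indicatorConstLp_coeFn (p := 2) (hs := measurableSet_Iic (a := u)) (hμs := hfin u)
        (c := (1 : ℝ))] with t h1 h2 h3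
    rw [summandLp, h1, h2, Pi.smul_apply, h3, summand, smul_eq_mul]
    simp [Set.indicator_apply]
  rw [heq]
  fun_prop

theorem inner_summandLp (f : H) (u : ℝ) :
    ⟪f, summandLp u⟫ = ∫ t, summand u t * f t ∂vol01 := by
  rw [L2.inner_def]
  refine integral_congr_ae ?_
  filter_upwards [(memLp_summand u).coeFn_toLp] with t ht
  rw [summandLp, ht]
  rfl

theorem summand_mul_summand (u s t : ℝ) : summand u s * summand u t =
    (2 * u - 1) ^ 2 * (Set.Ici (max s t)).indicator (fun _ => (1 : ℝ)) u := by
  by_cases hs : s ≤ u <;> by_cases ht : t ≤ u <;> simp [summand, hs, ht, sq]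

theorem norm_summandLp_le {u : ℝ} (hu : u ∈ Set.Ioo (0 : ℝ) 1) : ‖summandLp u‖ ≤ 1 := by
  have h : ∀ᵐ t ∂vol01, ‖summandLp u t‖ ≤ 1 := by
    filter_upwards [(memLp_summand u).coeFn_toLp] with t ht
    rw [summandLp, ht]
    refine (abs_summand_le _ _).trans (abs_le.2 ⟨?_, ?_⟩) <;> linarith [hu.1, hu.2]
  have hvol : measureUnivNNReal vol01 = 1 := by simp [measureUnivNNReal]
  simpa [hvol] using Lp.norm_le_of_ae_bound zero_le_one h

/-! ### Mean and covariance -/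

section

variable {Ω : Type*} [MeasurableSpace Ω] {P : Measure Ω} [IsProbabilityMeasure P]
  {U : Ω → ℝ} (hU : AEMeasurable U P) (hU01 : ∀ᵐ ω ∂P, U ω ∈ Set.Ioo (0 : ℝ) 1)

include hU hU01

/-- Integrability for the applications of Fubini's theorem: the summand is a.s. bounded by `1`
because `U` takes its values in `(0,1)`. -/
theorem integrable_summand_mul_comp {α : Type*} [MeasurableSpace α] {μ : Measure α} [SFinite μ]
    {φ : α → ℝ} (hφ : Integrable φ μ) {a : α → ℝ} (ha : Measurable a) :
    Integrable (fun p : Ω × α => summand (U p.1) (a p.2) * φ p.2) (P.prod μ) := by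
  refine (hφ.comp_snd P).bdd_mul (c := 1) ?_ ?_
  · exact (measurable_summand.comp_aemeasurable
      (hU.comp_fst.prodMk (ha.comp measurable_snd).aemeasurable)).aestronglyMeasurable
  · filter_upwards [Measure.quasiMeasurePreserving_fst.ae hU01] with p hp
    refine (abs_summand_le _ _).trans (abs_le.2 ⟨?_, ?_⟩) <;> linarith [hp.1, hp.2]

theorem integral_inner_summandLp (f : H) :
    ∫ ω, ⟪f, summandLp (U ω)⟫ ∂P = ∫ t, Psi P U t * f t ∂vol01 := by
  simp_rw [inner_summandLp]
  rw [integral_integral_swap]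
  · simp_rw [integral_mul_const]
    rfl
  · exact integrable_summand_mul_comp hU hU01 ((Lp.memLp f).integrable one_le_two) measurable_id

theorem integrable_summand_mul_summand (f g : H) :
    Integrable (fun p : Ω × (ℝ × ℝ) => summand (U p.1) p.2.1 * summand (U p.1) p.2.2 *
      (f p.2.1 * g p.2.2)) (P.prod (vol01.prod vol01)) := by
  have h1 := integrable_summand_mul_comp hU hU01
    (((Lp.memLp f).integrable one_le_two).mul_prod ((Lp.memLp g).integrable one_le_two))
    (a := Prod.snd) measurable_snd
  have h2 := h1.bdd_mul (c := 1) (f := fun p : Ω × (ℝ × ℝ) => summand (U p.1) p.2.1) ?_ ?_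
  · simpa only [mul_assoc] using h2
  · exact (measurable_summand.comp_aemeasurable
      (hU.comp_fst.prodMk (measurable_fst.comp measurable_snd).aemeasurable)).aestronglyMeasurable
  · filter_upwards [Measure.quasiMeasurePreserving_fst.ae hU01] with p hp
    refine (abs_summand_le _ _).trans (abs_le.2 ⟨?_, ?_⟩) <;> linarith [hp.1, hp.2]

theorem integral_inner_mul_inner_summandLp (f g : H) :
    ∫ ω, ⟪f, summandLp (U ω)⟫ * ⟪g, summandLp (U ω)⟫ ∂P =
      ∫ p, (∫ ω, (2 * U ω - 1) ^ 2 *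
        (Set.Ici (max p.1 p.2)).indicator (fun _ => (1 : ℝ)) (U ω) ∂P) * (f p.1 * g p.2)
        ∂(vol01.prod vol01) := by
  have h (ω : Ω) : ⟪f, summandLp (U ω)⟫ * ⟪g, summandLp (U ω)⟫ =
      ∫ p, summand (U ω) p.1 * summand (U ω) p.2 * (f p.1 * g p.2) ∂(vol01.prod vol01) := by
    rw [inner_summandLp, inner_summandLp, ← integral_prod_mul]
    congr with p
    ring
  simp_rw [h]
  rw [integral_integral_swap (integrable_summand_mul_summand hU hU01 f g)]
  simp_rw [integral_mul_const, summand_mul_summand]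

theorem memLp_summandLp_comp (p : ℝ≥0∞) : MemLp (fun ω => summandLp (U ω)) p P := by
  exact MemLp.of_bound
    (continuous_summandLp.measurable.comp_aemeasurable hU).aestronglyMeasurable 1
    (hU01.mono fun ω hω => norm_summandLp_le hω)

theorem covariance_inner_summandLp (f g : H) :
    cov[fun ω => ⟪f, summandLp (U ω)⟫, fun ω => ⟪g, summandLp (U ω)⟫; P] =
      ∫ s in Set.Ioo (0 : ℝ) 1, ∫ t in Set.Ioo (0 : ℝ) 1, covKernel P U s t * f s * g t := by
  have hLp := memLp_summandLp_comp hU hU01 2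
  rw [covariance_eq_sub (hLp.const_inner f) (hLp.const_inner g)]
  simp only [Pi.mul_apply]
  have hPsi (f : H) : Integrable (fun t => Psi P U t * f t) vol01 :=
    (integrable_summand_mul_comp hU hU01 ((Lp.memLp f).integrable one_le_two)
      measurable_id).integral_prod_right.congr
      (Eventually.of_forall fun t => by simp only [id, integral_mul_const]; rfl)
  have hsecond : Integrable (fun p : ℝ × ℝ => (∫ ω, (2 * U ω - 1) ^ 2 *
      (Set.Ici (max p.1 p.2)).indicator (fun _ => (1 : ℝ)) (U ω) ∂P) * (f p.1 * g p.2))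
      (vol01.prod vol01) :=
    (integrable_summand_mul_summand hU hU01 f g).integral_prod_right.congr
      (Eventually.of_forall fun p => by simp only [integral_mul_const, summand_mul_summand])
  have hprod := (hPsi f).mul_prod (hPsi g)
  rw [integral_inner_mul_inner_summandLp hU hU01, integral_inner_summandLp hU hU01,
    integral_inner_summandLp hU hU01, ← integral_prod_mul, ← integral_sub' hsecond hprod,
    integral_prod _ (hsecond.sub hprod)]
  congr with s
  congr with t
  simp only [Pi.sub_apply, covKernel]
  ring

/-- The class of `Ψ` in `H`, the Bochner mean of `summandLp (U ω)`. -/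
noncomputable def PsiLp : H := (memLp_Psi P hU hU01).toLp (Psi P U)

theorem integral_summandLp_sub_PsiLp : ∫ ω, (summandLp (U ω) - PsiLp hU hU01) ∂P = 0 := by
  have hint : Integrable (fun ω => summandLp (U ω)) P :=
    (memLp_summandLp_comp hU hU01 1).integrable le_rfl
  rw [integral_sub hint (integrable_const _), integral_const, sub_eq_zero]
  refine ext_inner_left ℝ fun f => ?_
  rw [← integral_inner hint, integral_inner_summandLp hU hU01, L2.inner_def]
  simp only [probReal_univ, one_smul]
  refine integral_congr_ae ?_
  filter_upwards [(memLp_Psi P hU hU01).coeFn_toLp] with t ht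
  rw [PsiLp, ht]
  rfl

theorem Wn_eq_normalizedSum {Ω' : Type*} (X : ℕ → Ω' → ℝ) (n : ℕ) :
    Wn P hU hU01 X n =
      HilbertCLT.normalizedSum (fun j ω => summandLp (X j ω) - PsiLp hU hU01) n := by
  funext ω
  have hsum : ∀ᵐ t ∂vol01, ∀ j, summandLp (X j ω) t = summand (X j ω) t :=
    ae_all_iff.2 fun j => (memLp_summand (X j ω)).coeFn_toLp
  have hsub : ∀ᵐ t ∂vol01, ∀ j, (summandLp (X j ω) - PsiLp hU hU01) t =
      summandLp (X j ω) t - PsiLp hU hU01 t :=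
    ae_all_iff.2 fun j => Lp.coeFn_sub _ _
  have hPsi : ∀ᵐ t ∂vol01, PsiLp hU hU01 t = Psi P U t := (memLp_Psi P hU hU01).coeFn_toLp
  refine Lp.ext ?_
  filter_upwards [hsum, hsub, hPsi,
    (memLp_processFun P hU hU01 (fun j => X j ω) n).coeFn_toLp,
    Lp.coeFn_fun_finsetSum (Finset.range n) fun j => summandLp (X j ω) - PsiLp hU hU01,
    Lp.coeFn_smul (√(n : ℝ))⁻¹ (∑ j ∈ Finset.range n, (summandLp (X j ω) - PsiLp hU hU01))]
    with t h1 h2 h3 h4 h5 h6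
  rw [Wn, h4, HilbertCLT.normalizedSum, h6, Pi.smul_apply, h5]
  simp only [h2, h1, h3, processFun, smul_eq_mul, Finset.sum_sub_distrib,
    Finset.sum_const, Finset.card_range, nsmul_eq_mul]
  rcases eq_or_ne n 0 with rfl | hn
  · simp
  · have hn0 : (n : ℝ) ≠ 0 := Nat.cast_ne_zero.2 hn
    -- `(√n)⁻¹ = √n * n⁻¹`
    rw [← Real.sqrt_div_self, div_eq_mul_inv, mul_assoc, mul_sub (n : ℝ)⁻¹,
      inv_mul_cancel_left₀ hn0]

end

end UniformityTest

theorem theorem2p2 {Ω Ω' : Type*} [MeasurableSpace Ω] [MeasurableSpace Ω']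
    (P : Measure Ω) [IsProbabilityMeasure P] (P' : Measure Ω') [IsProbabilityMeasure P']
    (U : Ω → ℝ) (hU : AEMeasurable U P) (hU01 : ∀ᵐ ω ∂P, U ω ∈ Set.Ioo (0 : ℝ) 1)
    (hac : P.map U ≪ volume)
    (X : ℕ → Ω' → ℝ) (hindep : iIndepFun X P') (hident : ∀ j, IdentDistrib (X j) U P' P) :
    ∃ (ΩW : Type) (_ : MeasurableSpace ΩW) (Q : Measure ΩW) (_ : IsProbabilityMeasure Q)
      (W : ΩW → UniformityTest.H),
      UniformityTest.IsCentredGaussianWithKernel Q W (UniformityTest.covKernel P U) ∧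
      TendstoInDistribution (UniformityTest.Wn P hU hU01 X) atTop W (fun _ => P') Q := by
  open UniformityTest in
  have hg : Measurable fun u => summandLp u - PsiLp hU hU01 :=
    (continuous_summandLp.sub continuous_const).measurable
  have hid j : IdentDistrib (fun ω => summandLp (X j ω) - PsiLp hU hU01)
      (fun ω => summandLp (U ω) - PsiLp hU hU01) P' P := (hident j).comp hg
  have hLp : MemLp (fun ω => summandLp (U ω) - PsiLp hU hU01) 2 P :=
    (memLp_summandLp_comp hU hU01 2).sub (memLp_const _)
  obtain ⟨μ, hgauss, hmean, hcov, hconv⟩ := HilbertCLT.exists_isGaussian_tendsto_map_normalizedSum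
    (X := fun j ω => summandLp (X j ω) - PsiLp hU hU01) (P := P')
    (hindep.comp (fun _ u => summandLp u - PsiLp hU hU01) fun _ => hg)
    (fun j => (hid j).trans (hid 0).symm) ((hid 0).memLp_iff.2 hLp)
    ((hid 0).integral_eq.trans (integral_summandLp_sub_PsiLp hU hU01))
  refine ⟨H, inferInstance, (μ : Measure H), inferInstance, id,
    ⟨measurable_id, by rwa [Measure.map_id], fun f => ?_, fun f g => ?_⟩, ?_⟩
  · have h := integral_inner (𝕜 := ℝ) (IsGaussian.integrable_id (μ := (μ : Measure H))) f
    simpa only [id, hmean, inner_zero_right] using h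
  · have hmeas : AEMeasurable (fun ω => summandLp (U ω) - PsiLp hU hU01) P :=
      hg.comp_aemeasurable hU
    have hLp' := memLp_summandLp_comp hU hU01 1
    calc cov[fun x : H => ⟪f, x⟫, fun x => ⟪g, x⟫; (μ : Measure H)]
        = covarianceBilin (P.map fun ω => summandLp (U ω) - PsiLp hU hU01) f g := by
          rw [← covarianceBilin_apply_eq_cov IsGaussian.memLp_two_id, hcov, (hid 0).map_eq]
      _ = cov[fun ω => ⟪f, summandLp (U ω) - PsiLp hU hU01⟫,
            fun ω => ⟪g, summandLp (U ω) - PsiLp hU hU01⟫; P] := by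
          have := Measure.isProbabilityMeasure_map (μ := P) hmeas
          rw [covarianceBilin_apply_eq_cov
            ((memLp_map_measure_iff aestronglyMeasurable_id hmeas).2 hLp),
            covariance_map_fun (by fun_prop) (by fun_prop) hmeas]
      _ = cov[fun ω => ⟪f, summandLp (U ω)⟫, fun ω => ⟪g, summandLp (U ω)⟫; P] := by
          simp_rw [inner_sub_right]
          rw [covariance_sub_const_left, covariance_sub_const_right]
          · exact (hLp'.const_inner g).integrable le_rfl
          · exact (hLp'.const_inner f).integrable le_rfl
      _ = _ := covariance_inner_summandLp hU hU01 f g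
  · simpa only [funext (Wn_eq_normalizedSum hU hU01 X)] using hconv
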